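/- Let $d\ge 1$ and let $L$ be a finite set of (affine) hyperplanes in $\mathbb{R}^d$ inducing a simple arrangement, i.e., for every $k\le d$ any $k$ distinct hyperplanes of $L$ intersect in a nonempty affine subspace of dimension $d-k$, and no point lies on more than $d$ hyperplanes of $L$. Suppose that every hyperplane of $L$ is assigned one of $d+1$ colors and that each of the $d+1$ colors is assigned to at least one hyperplane of $L$. Then there exist two distinct points $x,y\in\mathbb{R}^d$, neither of them lying on any hyperplane of $L$, such that for each of the $d+1$ colors the closed segment $xy$ intersects exactly one hyperplane of $L$ of that color. -/

import Mathlib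

/-- A hyperplane of `ℝ^d`: a nonempty affine subspace of dimension `d - 1`. -/
def IsHyperplane {d : ℕ} (H : AffineSubspace ℝ (EuclideanSpace ℝ (Fin d))) : Prop :=
  (H : Set (EuclideanSpace ℝ (Fin d))).Nonempty ∧ Module.finrank ℝ H.direction + 1 = d

/-- The finite set `L` of hyperplanes of `ℝ^d` induces a simple arrangement: any `k ≤ d` of the
hyperplanes meet in a (nonempty) flat of dimension `d - k`, and any `k > d` of them have no
common point. -/
def IsSimpleArrangement {d : ℕ} (L : Finset (AffineSubspace ℝ (EuclideanSpace ℝ (Fin d)))) :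
    Prop :=
  (∀ S ⊆ L, S.card ≤ d →
    ((S.inf id : AffineSubspace ℝ (EuclideanSpace ℝ (Fin d))) :
      Set (EuclideanSpace ℝ (Fin d))).Nonempty ∧
    Module.finrank ℝ (S.inf id).direction + S.card = d) ∧
  (∀ S ⊆ L, d < S.card → S.inf id = ⊥)

/-! Fix a direction `u` parallel to no hyperplane and write each `H` in `L` as `f H x = b H` with `f
H u = 1`, so that `|f H x - b H|` is the distance from `x` to `H` along `u`. Suppose that at a point
`p` the nearest hyperplane of every color is at the same distance `r`. As no point lies on `d + 1`
hyperplanes, `r > 0`. The segment from `p - r • u` to `p + r • u` then meets hyperplanes only at its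
endpoints, and meets every color. By simplicity the endpoints can be perturbed so that each
hyperplane through them is crossed or avoided at will; one per color is kept.

The point `p` comes from a KKM-type argument. One hyperplane of each color gives the facets of a
(possibly degenerate) simplex, and the distance to a color vanishes on its own facet. The cube is
mapped onto this simplex and Poincaré–Miranda equalizes the distances
(`IsSimpleArrangement.exists_equidistant`). Poincaré–Miranda follows from Kuhn's cube lemma, proved
by a mod 2 cup product whose total over the box is `1`. -/

section CubicalCup

/-! ### Mod 2 cubical cochains and cup products. -/

variable {ι : Type*} [DecidableEq ι]

/-- The iterated cubical cup product modulo 2 of the differentials of the functions in a list,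
evaluated at the cube with lowest corner `v` and set of directions `R`. -/
def cupDiff : List ((ι → ℕ) → ZMod 2) → (ι → ℕ) → Finset ι → ZMod 2
  | [], _, _ => 1
  | f :: l, v, R =>
      ∑ j ∈ R, (f (v + Pi.single j 1) + f v) * cupDiff l (v + Pi.single j 1) (R.erase j)

/-- The cubical coboundary modulo 2. -/
def cubeCoboundary (η : (ι → ℕ) → Finset ι → ZMod 2) (v : ι → ℕ) (R : Finset ι) : ZMod 2 :=
  ∑ j ∈ R, (η v (R.erase j) + η (v + Pi.single j 1) (R.erase j))

lemma sum_offDiag_symm_zmod_two (R : Finset ι) (A : ι → ι → ZMod 2)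
    (hA : ∀ j k, A j k = A k j) : ∑ j ∈ R, ∑ k ∈ R.erase j, A j k = 0 := by
  rw [Finset.sum_sigma']
  refine Finset.sum_involution (fun x _ => ⟨x.2, x.1⟩) ?_ ?_ ?_ ?_
  · rintro ⟨j, k⟩ _
    simp only [hA k j]
    exact CharTwo.add_self_eq_zero _
  · rintro ⟨j, k⟩ h _ h'
    simp only [Finset.mem_sigma, Finset.mem_erase] at h
    simp only [Sigma.mk.injEq] at h'
    exact h.2.1 h'.1
  · rintro ⟨j, k⟩ h
    simp only [Finset.mem_sigma, Finset.mem_erase] at h ⊢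
    exact ⟨h.2.2, h.2.1.symm, h.1⟩
  · rintro ⟨j, k⟩ _
    rfl

lemma cubeCoboundary_comp_self (η : (ι → ℕ) → Finset ι → ZMod 2) (v : ι → ℕ) (R : Finset ι) :
    cubeCoboundary (cubeCoboundary η) v R = 0 := by
  have h : cubeCoboundary (cubeCoboundary η) v R = ∑ j ∈ R, ∑ k ∈ R.erase j,
      ((η v ((R.erase j).erase k) + η (v + Pi.single k 1) ((R.erase j).erase k)) +
        (η (v + Pi.single j 1) ((R.erase j).erase k) +
          η (v + Pi.single j 1 + Pi.single k 1) ((R.erase j).erase k))) := by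
    simp only [cubeCoboundary, ← Finset.sum_add_distrib]
  rw [h]
  refine sum_offDiag_symm_zmod_two R _ fun j k => ?_
  rw [Finset.erase_right_comm (a := j), add_right_comm v]
  ring

/-- Leibniz rule for a 0-cochain times a cochain. -/
lemma cubeCoboundary_mul (f : (ι → ℕ) → ZMod 2) (η : (ι → ℕ) → Finset ι → ZMod 2)
    (v : ι → ℕ) (R : Finset ι) :
    cubeCoboundary (fun v R => f v * η v R) v R =
      ∑ j ∈ R, (f (v + Pi.single j 1) + f v) * η (v + Pi.single j 1) (R.erase j) +
        f v * cubeCoboundary η v R := by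
  simp only [cubeCoboundary, Finset.mul_sum, ← Finset.sum_add_distrib]
  refine Finset.sum_congr rfl fun j _ => ?_
  linear_combination -(CharTwo.add_self_eq_zero (f v * η (v + Pi.single j 1) (R.erase j)))

lemma cubeCoboundary_cupDiff (l : List ((ι → ℕ) → ZMod 2)) (v : ι → ℕ) (R : Finset ι) :
    cubeCoboundary (cupDiff l) v R = 0 := by
  induction l generalizing v R with
  | nil => exact Finset.sum_eq_zero fun _ _ => CharTwo.add_self_eq_zero _
  | cons f l ih =>
    have h : cupDiff (f :: l) = cubeCoboundary (fun v R => f v * cupDiff l v R) := by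
      funext v R
      rw [cubeCoboundary_mul, ih, mul_zero, add_zero, cupDiff]
    rw [h, cubeCoboundary_comp_self]

/-- The tail is closed, so the Leibniz rule makes the whole product exact; this lets box sums
collapse to the boundary. -/
lemma cupDiff_cons (f : (ι → ℕ) → ZMod 2) (l : List ((ι → ℕ) → ZMod 2)) (v : ι → ℕ)
    (R : Finset ι) :
    cupDiff (f :: l) v R = cubeCoboundary (fun v R => f v * cupDiff l v R) v R := by
  rw [cubeCoboundary_mul, cubeCoboundary_cupDiff, mul_zero, add_zero, cupDiff]

/-- A cup product of differentials vanishes on a cube lying in a coordinate hyperplane on which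
one of the functions is constant. -/
lemma cupDiff_eq_zero (f : ι → (ι → ℕ) → ZMod 2) (k : ι) (a : ℕ) (c : ZMod 2)
    (hf : ∀ v : ι → ℕ, v k = a → f k v = c) (l : List ι) (hk : k ∈ l) (v : ι → ℕ)
    (R : Finset ι) (hR : k ∉ R) (hv : v k = a) : cupDiff (l.map f) v R = 0 := by
  induction l generalizing v R with
  | nil => simp at hk
  | cons i l ih =>
    rw [List.map_cons, cupDiff]
    refine Finset.sum_eq_zero fun j hj => ?_
    have hjk : k ≠ j := fun h => hR (h ▸ hj)
    have hv' : (v + Pi.single j 1 : ι → ℕ) k = a := by simp [hjk, hv]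
    rcases List.mem_cons.1 hk with rfl | hk
    · rw [hf _ hv', hf _ hv, CharTwo.add_self_eq_zero, zero_mul]
    · rw [ih hk _ _ (fun h => hR (Finset.mem_of_mem_erase h)) hv', mul_zero]

/-- A nonzero term of the expanded product is a monotone edge path in the cube, each function of the
list changing along its own edge. -/
lemma exists_ne_of_cupDiff_ne_zero (f : ι → (ι → ℕ) → ZMod 2) (l : List ι) (v : ι → ℕ)
    (R : Finset ι) (h : cupDiff (l.map f) v R ≠ 0) (i : ι) (hi : i ∈ l) :
    ∃ w w' : ι → ℕ, v ≤ w ∧ v ≤ w' ∧ (∀ j, w j ≤ v j + if j ∈ R then 1 else 0) ∧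
      (∀ j, w' j ≤ v j + if j ∈ R then 1 else 0) ∧ f i w ≠ f i w' := by
  induction l generalizing v R with
  | nil => simp at hi
  | cons k l ih =>
    rw [List.map_cons, cupDiff] at h
    obtain ⟨j, hj, hne⟩ := Finset.exists_ne_zero_of_sum_ne_zero h
    have hup : ∀ m, (v + Pi.single j 1 : ι → ℕ) m ≤ v m + if m ∈ R then 1 else 0 := by
      intro m
      rcases eq_or_ne m j with rfl | hm
      · simp [hj]
      · simp [hm]
    rcases List.mem_cons.1 hi with rfl | hi
    · refine ⟨v + Pi.single j 1, v, le_self_add, le_rfl, hup, fun _ => Nat.le_add_right _ _, ?_⟩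
      intro he
      rw [he, CharTwo.add_self_eq_zero, zero_mul] at hne
      exact hne rfl
    · obtain ⟨w, w', h1, h2, h3, h4, h5⟩ := ih _ _ (right_ne_zero_of_mul hne) hi
      have key : ∀ m, (v + Pi.single j 1 : ι → ℕ) m + (if m ∈ R.erase j then 1 else 0) ≤
          v m + if m ∈ R then 1 else 0 := by
        intro m
        rcases eq_or_ne m j with rfl | hm
        · simp [hj]
        · simp [hm]
      exact ⟨w, w', le_self_add.trans h1, le_self_add.trans h2, fun m => (h3 m).trans (key m),
        fun m => (h4 m).trans (key m), h5⟩

/-! ### Box sums and Kuhn's lemma. -/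

variable [Fintype ι]

/-- The lattice points of the box of side `n` in the directions `R` through `b`. -/
def latticeBox (n : ℕ) (R : Finset ι) (b : ι → ℕ) : Finset (ι → ℕ) :=
  Fintype.piFinset fun i => if i ∈ R then Finset.range n else {b i}

lemma mem_latticeBox {n : ℕ} {R : Finset ι} {b v : ι → ℕ} :
    v ∈ latticeBox n R b ↔ ∀ i, if i ∈ R then v i < n else v i = b i := by
  simp only [latticeBox, Fintype.mem_piFinset]
  refine forall_congr' fun i => ?_
  split_ifs <;> simp

lemma sum_latticeBox (n : ℕ) (R : Finset ι) (b : ι → ℕ) (k : ι) (hk : k ∈ R)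
    (g : (ι → ℕ) → ZMod 2) :
    ∑ v ∈ latticeBox n R b, g v =
      ∑ a ∈ Finset.range n, ∑ v ∈ latticeBox n (R.erase k) (Function.update b k a), g v := by
  have hmaps : ∀ v ∈ latticeBox n R b, v k ∈ Finset.range n := fun v hv => by
    simpa [hk] using mem_latticeBox.1 hv k
  rw [← Finset.sum_fiberwise_of_maps_to hmaps]
  refine Finset.sum_congr rfl fun a ha => Finset.sum_congr ?_ fun _ _ => rfl
  ext v
  rw [Finset.mem_filter, mem_latticeBox, mem_latticeBox]
  rw [Finset.mem_range] at ha
  constructor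
  · rintro ⟨h, rfl⟩ i
    rcases eq_or_ne i k with rfl | hi
    · simp
    · simpa [hi] using h i
  · intro h
    have hva : v k = a := by simpa using h k
    refine ⟨fun i => ?_, hva⟩
    rcases eq_or_ne i k with rfl | hi
    · simpa [hk, hva] using ha
    · simpa [hi] using h i

lemma sum_latticeBox_shift (n : ℕ) (R : Finset ι) (b : ι → ℕ) (k : ι) (hk : k ∉ R) (a : ℕ)
    (g : (ι → ℕ) → ZMod 2) :
    ∑ v ∈ latticeBox n R (Function.update b k a), g (v + Pi.single k 1) =
      ∑ v ∈ latticeBox n R (Function.update b k (a + 1)), g v := by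
  refine Finset.sum_bij (fun v _ => v + Pi.single k 1) ?_ ?_ ?_ fun _ _ => rfl
  · intro v hv
    rw [mem_latticeBox] at hv ⊢
    intro i
    have := hv i
    rcases eq_or_ne i k with rfl | hi
    · simpa [hk] using this
    · simpa [hi] using this
  · intro v _ w _ h
    exact add_right_cancel h
  · intro v hv
    rw [mem_latticeBox] at hv
    have hvk : v k = a + 1 := by simpa [hk] using hv k
    refine ⟨Function.update v k a, ?_, ?_⟩
    · rw [mem_latticeBox]
      intro i
      have := hv i
      rcases eq_or_ne i k with rfl | hi
      · simp [hk]
      · simpa [hi] using this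
    · funext i
      rcases eq_or_ne i k with rfl | hi
      · simp [hvk]
      · simp [hi]

lemma sum_latticeBox_telescope (n : ℕ) (R : Finset ι) (b : ι → ℕ) (k : ι) (hk : k ∈ R)
    (g : (ι → ℕ) → ZMod 2) :
    ∑ v ∈ latticeBox n R b, (g v + g (v + Pi.single k 1)) =
      ∑ v ∈ latticeBox n (R.erase k) (Function.update b k 0), g v +
        ∑ v ∈ latticeBox n (R.erase k) (Function.update b k n), g v := by
  rw [sum_latticeBox n R b k hk]
  simp only [Finset.sum_add_distrib,
    sum_latticeBox_shift n (R.erase k) b k (Finset.notMem_erase k R)]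
  have := Finset.sum_range_sub
    (fun a => ∑ v ∈ latticeBox n (R.erase k) (Function.update b k a), g v) n
  rw [Finset.sum_sub_distrib] at this
  simp only [CharTwo.sub_eq_add] at this
  rw [add_comm, this, add_comm]

/-- The total cup product over a box is `1` if the `i`-th function is `0` on the lower and `1` on
the upper face in direction `i`. -/
lemma sum_cupDiff_eq_one (n : ℕ) (f : ι → (ι → ℕ) → ZMod 2)
    (h0 : ∀ i (v : ι → ℕ), v i = 0 → f i v = 0) (h1 : ∀ i (v : ι → ℕ), v i = n → f i v = 1)
    (l : List ι) (hl : l.Nodup) (b : ι → ℕ) :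
    ∑ v ∈ latticeBox n l.toFinset b, cupDiff (l.map f) v l.toFinset = 1 := by
  induction l generalizing b with
  | nil =>
    have : latticeBox n ([] : List ι).toFinset b = {b} := by
      ext v
      simp [mem_latticeBox, funext_iff]
    rw [this, Finset.sum_singleton, List.map_nil, cupDiff]
  | cons j l ih =>
    obtain ⟨hj, hl⟩ := List.nodup_cons.1 hl
    have her : (j :: l).toFinset.erase j = l.toFinset := by
      rw [List.toFinset_cons, Finset.erase_insert (by simpa using hj)]
    simp only [List.map_cons, cupDiff_cons, cubeCoboundary]
    -- Stokes: only the upper face in direction `j` contributes, where `f j = 1` leaves the product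
    -- for `l`. On faces in a direction `k ≠ j` the factor of `f k` is zero, `f k` being constant
    -- there.
    rw [Finset.sum_comm, Finset.sum_eq_single_of_mem j (by simp)]
    · rw [sum_latticeBox_telescope n _ b j (by simp)
        (fun v => f j v * cupDiff (l.map f) v ((j :: l).toFinset.erase j)), her]
      have hz : ∀ a, ∀ v ∈ latticeBox n l.toFinset (Function.update b j a), v j = a := by
        intro a v hv
        have := mem_latticeBox.1 hv j
        simpa [hj] using this
      rw [Finset.sum_eq_zero fun v hv => by rw [h0 j v (hz _ v hv), zero_mul], zero_add,
        ← ih hl (Function.update b j n)]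
      exact Finset.sum_congr rfl fun v hv => by rw [h1 j v (hz _ v hv), one_mul]
    · intro k hk hkj
      rw [sum_latticeBox_telescope n _ b k hk
        (fun v => f j v * cupDiff (l.map f) v ((j :: l).toFinset.erase k))]
      have hkl : k ∈ l := by simpa [hkj] using hk
      have hz : ∀ a c, (∀ v : ι → ℕ, v k = a → f k v = c) →
          ∑ v ∈ latticeBox n ((j :: l).toFinset.erase k) (Function.update b k a),
            f j v * cupDiff (l.map f) v ((j :: l).toFinset.erase k) = 0 := by
        intro a c hc
        refine Finset.sum_eq_zero fun v hv => ?_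
        have hva : v k = a := by simpa using mem_latticeBox.1 hv k
        rw [cupDiff_eq_zero f k a c hc l hkl v _ (Finset.notMem_erase k _) hva, mul_zero]
      rw [hz 0 0 (h0 k), hz n 1 (h1 k), add_zero]

/-- **Kuhn's cube lemma**. -/
theorem exists_cube_of_labels (n : ℕ) (f : ι → (ι → ℕ) → ZMod 2)
    (h0 : ∀ i (v : ι → ℕ), v i = 0 → f i v = 0) (h1 : ∀ i (v : ι → ℕ), v i = n → f i v = 1) :
    ∃ v : ι → ℕ, (∀ i, v i < n) ∧ ∀ i, ∃ w w' : ι → ℕ,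
      v ≤ w ∧ v ≤ w' ∧ (∀ j, w j ≤ v j + 1) ∧ (∀ j, w' j ≤ v j + 1) ∧
        f i w = 0 ∧ f i w' = 1 := by
  have hsum := sum_cupDiff_eq_one n f h0 h1 (Finset.univ : Finset ι).toList
    (Finset.nodup_toList _) 0
  rw [Finset.toList_toFinset] at hsum
  obtain ⟨v, hv, hne⟩ := Finset.exists_ne_zero_of_sum_ne_zero (hsum.trans_ne one_ne_zero)
  refine ⟨v, fun i => by simpa using mem_latticeBox.1 hv i, fun i => ?_⟩
  obtain ⟨w, w', h1, h2, h3, h4, h5⟩ := exists_ne_of_cupDiff_ne_zero f _ v _ hne i (by simp)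
  simp only [Finset.mem_univ, if_true] at h3 h4
  have hz : ∀ a b : ZMod 2, a ≠ b → (a = 0 ∧ b = 1) ∨ (b = 0 ∧ a = 1) := by decide
  rcases hz _ _ h5 with h | h
  · exact ⟨w, w', h1, h2, h3, h4, h⟩
  · exact ⟨w', w, h2, h1, h4, h3, h⟩

/-! ### From labels to zeros of continuous functions. -/

/-- **Poincaré–Miranda theorem** on the unit cube. -/
theorem poincare_miranda (g : ι → (ι → ℝ) → ℝ) (hg : ∀ i, Continuous (g i))
    (h0 : ∀ i, ∀ s ∈ Set.Icc (0 : ι → ℝ) 1, s i = 0 → g i s ≤ 0)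
    (h1 : ∀ i, ∀ s ∈ Set.Icc (0 : ι → ℝ) 1, s i = 1 → 0 ≤ g i s) :
    ∃ s, ∀ i, g i s = 0 := by
  classical
  have step : ∀ n : ℕ, ∃ s ∈ Set.Icc (0 : ι → ℝ) 1, ∀ i, ∃ t t' : ι → ℝ,
      dist t s ≤ 1 / ((n : ℝ) + 1) ∧ dist t' s ≤ 1 / ((n : ℝ) + 1) ∧ g i t ≤ 0 ∧ 0 ≤ g i t' := by
    intro n
    set q : (ι → ℕ) → ι → ℝ := fun v j => v j / ((n : ℝ) + 1) with hq
    have hn : (0 : ℝ) < (n : ℝ) + 1 := by positivity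
    -- Labels record the sign of `g i`, overridden on the two faces in direction `i`, where `h0` and
    -- `h1` keep the label compatible with the weak sign.
    obtain ⟨v, hv, H⟩ := exists_cube_of_labels (n + 1)
      (fun i v => if v i = 0 then 0 else if v i = n + 1 then 1 else if g i (q v) ≤ 0 then 0 else 1)
      (fun i v h => by simp [h]) (fun i v h => by simp [h])
    have hmem : ∀ w : ι → ℕ, (∀ j, w j ≤ v j + 1) → q w ∈ Set.Icc (0 : ι → ℝ) 1 := by
      intro w hw
      refine ⟨fun j => by simp only [hq, Pi.zero_apply]; positivity, fun j => ?_⟩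
      simp only [hq, Pi.one_apply]
      rw [div_le_one hn]
      exact_mod_cast (hw j).trans (hv j)
    have hdist : ∀ w : ι → ℕ, v ≤ w → (∀ j, w j ≤ v j + 1) →
        dist (q w) (q v) ≤ 1 / ((n : ℝ) + 1) := by
      intro w hw hw'
      rw [dist_pi_le_iff (by positivity)]
      intro j
      have e1 : (v j : ℝ) ≤ w j := by exact_mod_cast hw j
      have e2 : (w j : ℝ) ≤ v j + 1 := by exact_mod_cast hw' j
      rw [Real.dist_eq, hq, ← sub_div, abs_of_nonneg (div_nonneg (by linarith) hn.le)]
      gcongr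
      linarith
    refine ⟨q v, hmem v fun _ => Nat.le_succ _, fun i => ?_⟩
    obtain ⟨w, w', a1, a2, a3, a4, a5, a6⟩ := H i
    refine ⟨q w, q w', hdist w a1 a3, hdist w' a2 a4, ?_, ?_⟩
    · by_cases c0 : w i = 0
      · exact h0 i _ (hmem w a3) (by simp [hq, c0])
      · by_contra c
        by_cases c1 : w i = n + 1 <;> simp [c0, c1, c] at a5
    · by_cases c1 : w' i = n + 1
      · exact h1 i _ (hmem w' a4) (by simp only [hq, c1]; push_cast; exact div_self hn.ne')
      · by_contra c
        simp [c1, (not_le.1 c).le] at a6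
  choose s hs t t' ht ht' hgt hgt' using step
  obtain ⟨x, -, φ, hφ, hlim⟩ := (isCompact_Icc (a := (0 : ι → ℝ)) (b := 1)).tendsto_subseq hs
  have h1n : Filter.Tendsto (fun m => 1 / ((φ m : ℝ) + 1)) Filter.atTop (nhds 0) :=
    (tendsto_one_div_add_atTop_nhds_zero_nat (𝕜 := ℝ)).comp hφ.tendsto_atTop
  have conv : ∀ r : ℕ → ι → ℝ, (∀ n, dist (r n) (s n) ≤ 1 / ((n : ℝ) + 1)) →
      Filter.Tendsto (fun m => r (φ m)) Filter.atTop (nhds x) := by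
    intro r hr
    refine hlim.congr_dist (squeeze_zero (fun _ => dist_nonneg) (fun m => ?_) h1n)
    rw [dist_comm]
    exact hr (φ m)
  refine ⟨x, fun i => le_antisymm ?_ ?_⟩
  · exact le_of_tendsto (((hg i).tendsto x).comp (conv (fun n => t n i) fun n => ht n i))
      (Filter.Eventually.of_forall fun m => hgt (φ m) i)
  · exact ge_of_tendsto (((hg i).tendsto x).comp (conv (fun n => t' n i) fun n => ht' n i))
      (Filter.Eventually.of_forall fun m => hgt' (φ m) i)

end CubicalCup

/-! ### Hyperplanes as level sets, and general position. -/

lemma AffineSubspace.mem_finset_inf {k V P : Type*} [Ring k] [AddCommGroup V] [Module k V]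
    [AddTorsor V P] (S : Finset (AffineSubspace k P)) (x : P) :
    x ∈ S.inf id ↔ ∀ H ∈ S, x ∈ H := by
  classical
  induction S using Finset.induction_on with
  | empty => simp [AffineSubspace.mem_top]
  | insert H S _ ih => simp [Finset.inf_insert, AffineSubspace.mem_inf_iff, ih]

/-- A hyperplane is the level set of a linear functional normalized to be `1` at a given vector
that is not parallel to the hyperplane. -/
lemma IsHyperplane.exists_functional {d : ℕ} {H : AffineSubspace ℝ (EuclideanSpace ℝ (Fin d))}
    (hH : IsHyperplane H) {u : EuclideanSpace ℝ (Fin d)} (hu : u ∉ H.direction) :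
    ∃ (f : EuclideanSpace ℝ (Fin d) →ₗ[ℝ] ℝ) (b : ℝ), f u = 1 ∧ ∀ x, x ∈ H ↔ f x = b := by
  obtain ⟨⟨q, hq⟩, hdim⟩ := hH
  obtain ⟨f, hfu, hf⟩ := Submodule.exists_le_ker_of_notMem hu
  have hker : H.direction = LinearMap.ker f := by
    refine Submodule.eq_of_le_of_finrank_le hf ?_
    have h1 : Module.finrank ℝ (LinearMap.ker f) < Module.finrank ℝ (EuclideanSpace ℝ (Fin d)) :=
      Submodule.finrank_lt fun h => hfu (by
        have : u ∈ LinearMap.ker f := h ▸ Submodule.mem_top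
        exact this)
    rw [finrank_euclideanSpace_fin] at h1
    omega
  refine ⟨(f u)⁻¹ • f, (f u)⁻¹ * f q, by simp [hfu], fun x => ?_⟩
  have : x ∈ H ↔ x -ᵥ q ∈ H.direction := (AffineSubspace.vsub_right_mem_direction_iff_mem hq x).symm
  rw [this, hker, LinearMap.mem_ker, vsub_eq_sub, map_sub, sub_eq_zero, LinearMap.smul_apply,
    smul_eq_mul, mul_right_inj' (inv_ne_zero hfu)]

/-- Finitely many hyperplanes have a common transversal direction. -/
lemma exists_notMem_direction {d : ℕ} (L : Finset (AffineSubspace ℝ (EuclideanSpace ℝ (Fin d))))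
    (hL : ∀ H ∈ L, IsHyperplane H) :
    ∃ u : EuclideanSpace ℝ (Fin d), ∀ H ∈ L, u ∉ H.direction := by
  classical
  have h := Subspace.biUnion_ne_univ_of_top_notMem
    (s := L.image AffineSubspace.direction) (by
      intro h
      obtain ⟨H, hH, he⟩ := Finset.mem_image.1 h
      have := (hL H hH).2
      rw [he, finrank_top, finrank_euclideanSpace_fin] at this
      omega)
  obtain ⟨u, hu⟩ := (Set.ne_univ_iff_exists_notMem _).1 h
  refine ⟨u, fun H hH hm => hu ?_⟩
  simp only [Set.mem_iUnion]
  exact ⟨_, Finset.mem_image_of_mem _ hH, hm⟩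

/-- In a simple arrangement the functionals of the hyperplanes through a point take arbitrary
values at a common vector. -/
lemma IsSimpleArrangement.exists_apply_eq {d : ℕ}
    {L : Finset (AffineSubspace ℝ (EuclideanSpace ℝ (Fin d)))} (hL : IsSimpleArrangement L)
    (f : AffineSubspace ℝ (EuclideanSpace ℝ (Fin d)) → EuclideanSpace ℝ (Fin d) →ₗ[ℝ] ℝ)
    (b : AffineSubspace ℝ (EuclideanSpace ℝ (Fin d)) → ℝ)
    (hf : ∀ H ∈ L, ∀ x, x ∈ H ↔ f H x = b H) (y : EuclideanSpace ℝ (Fin d))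
    (ε : AffineSubspace ℝ (EuclideanSpace ℝ (Fin d)) → ℝ) :
    ∃ w, ∀ H ∈ L, y ∈ H → f H w = ε H := by
  classical
  set K := L.filter fun H => y ∈ H with hK
  have hKL : K ⊆ L := Finset.filter_subset _ _
  have hyK : ∀ S ⊆ K, y ∈ S.inf id := fun S hS =>
    (AffineSubspace.mem_finset_inf S y).2 fun H hH => (Finset.mem_filter.1 (hS hH)).2
  have hdir : ∀ S ⊆ K, ∀ w, w ∈ (S.inf id).direction ↔ ∀ H ∈ S, f H w = 0 := by
    intro S hS w
    rw [← AffineSubspace.vadd_mem_iff_mem_direction w (hyK S hS), AffineSubspace.mem_finset_inf]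
    refine forall₂_congr fun H hH => ?_
    have h1 := (hf H (hKL (hS hH)) y).1 (Finset.mem_filter.1 (hS hH)).2
    rw [hf H (hKL (hS hH)), vadd_eq_add, map_add, h1, add_eq_right]
  have hcard : K.card ≤ d := by
    by_contra h
    have := hyK K subset_rfl
    rw [hL.2 K hKL (not_le.1 h)] at this
    exact AffineSubspace.notMem_bot ℝ _ y this
  -- A dual family: without such a `w`, dropping `H` would not enlarge the common direction space,
  -- against the dimension count.
  have hdual : ∀ H ∈ K, ∃ w, f H w = 1 ∧ ∀ H' ∈ K, H' ≠ H → f H' w = 0 := by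
    intro H hH
    by_contra! hcon
    have hsub : K.erase H ⊆ K := Finset.erase_subset _ _
    have hle : ((K.erase H).inf id).direction ≤ (K.inf id).direction := by
      intro w hw
      rw [hdir _ hsub] at hw
      rw [hdir _ subset_rfl]
      by_contra! h
      obtain ⟨H', hH', hne⟩ := h
      have hHH : H' = H := by
        by_contra hHH
        exact hne (hw H' (Finset.mem_erase.2 ⟨hHH, hH'⟩))
      rw [hHH] at hne
      obtain ⟨H'', h1, h2, h3⟩ := hcon ((f H w)⁻¹ • w) (by simp [hne])
      exact h3 (by rw [map_smul, hw H'' (Finset.mem_erase.2 ⟨h2, h1⟩), smul_zero])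
    have e1 := (hL.1 K hKL hcard).2
    have e2 := (hL.1 _ (hsub.trans hKL) ((Finset.card_le_card hsub).trans hcard)).2
    have e3 := Submodule.finrank_mono hle
    have e4 := Finset.card_erase_add_one hH
    omega
  choose! w hw1 hw0 using hdual
  refine ⟨∑ H ∈ K, ε H • w H, fun H hH hy => ?_⟩
  have hHK : H ∈ K := Finset.mem_filter.2 ⟨hH, hy⟩
  rw [map_sum, Finset.sum_eq_single_of_mem H hHK]
  · rw [map_smul, hw1 H hHK, smul_eq_mul, mul_one]
  · intro H' hH' hne
    rw [map_smul, hw0 H' hH' H hHK hne.symm, smul_zero]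

lemma segment_inter_level_set {E : Type*} [AddCommGroup E] [Module ℝ E] (f : E →ₗ[ℝ] ℝ) (b : ℝ)
    (x y : E) (hx : f x < b) (hy : b < f y) : ∃ z ∈ segment ℝ x y, f z = b := by
  refine ⟨AffineMap.lineMap x y ((b - f x) / (f y - f x)), ?_, ?_⟩
  · rw [segment_eq_image_lineMap]
    refine ⟨_, ⟨div_nonneg (by linarith) (by linarith), ?_⟩, rfl⟩
    rw [div_le_one (by linarith)]
    linarith
  · have : f y - f x ≠ 0 := by linarith
    rw [AffineMap.lineMap_apply_module]
    simp only [map_add, map_smul, smul_eq_mul]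
    field_simp
    ring

lemma mul_pos_of_mem_segment {E : Type*} [AddCommGroup E] [Module ℝ E] (f : E →ₗ[ℝ] ℝ) (b : ℝ)
    (x y : E) (hxy : 0 < (f x - b) * (f y - b)) (z : E) (hz : z ∈ segment ℝ x y) : f z ≠ b := by
  obtain ⟨s, t, hs, ht, hst, rfl⟩ := hz
  rw [map_add, map_smul, map_smul, smul_eq_mul, smul_eq_mul]
  intro h
  have e : s * (f x - b) + t * (f y - b) = 0 := by
    linear_combination h - b * hst
  have hs' : s = 1 - t := by linarith
  subst hs'
  have h1 : (1 - t) * (f x - b) ^ 2 + t * ((f x - b) * (f y - b)) = 0 := by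
    linear_combination (f x - b) * e
  have hx0 : 0 < (f x - b) ^ 2 := by
    have := left_ne_zero_of_mul hxy.ne'
    positivity
  rcases ht.eq_or_lt with rfl | ht
  · linarith
  · nlinarith [mul_pos ht hxy, mul_nonneg hs hx0.le]

/-! ### The equidistant point. -/

/-- In a simple arrangement coloured with `d + 1` colours there is a point whose distances, along
a fixed direction, to the nearest hyperplanes of the various colours all agree. -/
lemma IsSimpleArrangement.exists_equidistant {d : ℕ}
    {L : Finset (AffineSubspace ℝ (EuclideanSpace ℝ (Fin d)))} (hL : IsSimpleArrangement L)
    (f : AffineSubspace ℝ (EuclideanSpace ℝ (Fin d)) → EuclideanSpace ℝ (Fin d) →ₗ[ℝ] ℝ)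
    (b : AffineSubspace ℝ (EuclideanSpace ℝ (Fin d)) → ℝ)
    (hf : ∀ H ∈ L, ∀ x, x ∈ H ↔ f H x = b H)
    (color : {H // H ∈ L} → Fin (d + 1)) (hcolor : Function.Surjective color) :
    ∃ (x : EuclideanSpace ℝ (Fin d)) (r : ℝ), (∀ H ∈ L, r ≤ |f H x - b H|) ∧
      ∀ c, ∃ H, color H = c ∧ |f H.1 x - b H.1| = r := by
  classical
  choose K hK using hcolor
  have hKinj : Function.Injective fun c => (K c).1 := fun c c' h => by
    rw [← hK c, ← hK c', Subtype.ext h]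
  -- `V j` is the vertex opposite facet `j`; that facet lies in `K j`.
  have hV : ∀ j, ∃ V : EuclideanSpace ℝ (Fin d), ∀ c ≠ j, V ∈ (K c).1 := by
    intro j
    set S := (Finset.univ.erase j).image fun c => (K c).1 with hS
    have hcard : S.card = d := by
      rw [hS, Finset.card_image_of_injective _ hKinj, Finset.card_erase_of_mem (Finset.mem_univ j),
        Finset.card_univ, Fintype.card_fin, Nat.add_sub_cancel]
    have hSL : S ⊆ L := by
      intro H hH
      obtain ⟨c, -, rfl⟩ := Finset.mem_image.1 hH
      exact (K c).2
    obtain ⟨V, hV⟩ := (hL.1 S hSL hcard.le).1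
    refine ⟨V, fun c hc => (AffineSubspace.mem_finset_inf S V).1 hV _ ?_⟩
    exact Finset.mem_image_of_mem _ (Finset.mem_erase.2 ⟨hc, Finset.mem_univ c⟩)
  choose V hV using hV
  have hne : ∀ c, (Finset.univ.filter fun H => color H = c).Nonempty := fun c =>
    ⟨K c, by simp [hK]⟩
  let D : Fin (d + 1) → EuclideanSpace ℝ (Fin d) → ℝ := fun c x =>
    (Finset.univ.filter fun H => color H = c).inf' (hne c) fun H => |f H.1 x - b H.1|
  have hDcont : ∀ c, Continuous (D c) := by
    intro c
    refine Continuous.finset_inf'_apply (hne c) fun H _ => ?_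
    exact ((f H.1).continuous_of_finiteDimensional.sub continuous_const).abs
  have hDle : ∀ H : {H // H ∈ L}, ∀ x, D (color H) x ≤ |f H.1 x - b H.1| := fun H x =>
    Finset.inf'_le (fun H : {H // H ∈ L} => |f H.1 x - b H.1|) (by simp)
  have hD0 : ∀ c x, 0 ≤ D c x := fun c x => Finset.le_inf' _ _ fun _ _ => abs_nonneg _
  have hDK : ∀ c x, f (K c).1 x = b (K c).1 → D c x = 0 := by
    intro c x h
    refine le_antisymm ?_ (hD0 c x)
    have := hDle (K c) x
    rwa [hK, h, sub_self, abs_zero] at this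
  -- Stick-breaking barycentric weights, with `∏ i, (1 - s i)` left for `V 0`. Thus `s i = 0` lands
  -- on the facet opposite `V i.succ`, and any `s i = 1` on the one opposite `V 0`.
  let w : Fin d → (Fin d → ℝ) → ℝ := fun i s =>
    s i * ∏ j ∈ Finset.univ.filter (· < i), (1 - s j)
  have hw1 : ∀ s, 1 - ∑ i, w i s = ∏ i, (1 - s i) := fun s =>
    (Finset.prod_one_sub_ordered Finset.univ s).symm
  let X : (Fin d → ℝ) → EuclideanSpace ℝ (Fin d) := fun s =>
    V 0 + ∑ i, w i s • (V i.succ - V 0)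
  have hXcont : Continuous X := by
    have hw : ∀ i, Continuous (w i) := fun i => (continuous_apply i).mul
      (continuous_finsetProd _ fun j _ => continuous_const.sub (continuous_apply j))
    exact continuous_const.add
      (continuous_finsetSum _ fun i _ => (hw i).smul continuous_const)
  have hfX : ∀ (g : EuclideanSpace ℝ (Fin d) →ₗ[ℝ] ℝ) s,
      g (X s) = g (V 0) + ∑ i, w i s * (g (V i.succ) - g (V 0)) := by
    intro g s
    simp [X, map_sum]
  have hfV : ∀ c j, c ≠ j → f (K c).1 (V j) = b (K c).1 := fun c j h =>
    (hf _ (K c).2 _).1 (hV j c h)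
  have hX0 : ∀ s i, s i = 1 → D 0 (X s) = 0 := by
    intro s i hs
    refine hDK _ _ ?_
    have hsum : ∑ i, w i s = 1 := by
      have := hw1 s
      rw [Finset.prod_eq_zero (Finset.mem_univ i) (by rw [hs, sub_self])] at this
      linarith
    rw [hfX, Finset.sum_congr rfl fun i _ => by rw [hfV 0 i.succ (Fin.succ_ne_zero i).symm],
      ← Finset.sum_mul, hsum]
    ring
  have hXi : ∀ s i, s i = 0 → D i.succ (X s) = 0 := by
    intro s i hs
    refine hDK _ _ ?_
    rw [hfX, hfV i.succ 0 (Fin.succ_ne_zero i), Finset.sum_eq_zero, add_zero]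
    intro k _
    rcases eq_or_ne i k with rfl | h
    · simp [w, hs]
    · rw [hfV i.succ k.succ (fun h' => h (Fin.succ_injective _ h')), sub_self, mul_zero]
  obtain ⟨s, hs⟩ := poincare_miranda (fun i s => D i.succ (X s) - D 0 (X s))
    (fun i => ((hDcont _).comp hXcont).sub ((hDcont _).comp hXcont))
    (fun i s _ h => by
      simp only [hXi s i h]
      linarith [hD0 0 (X s)])
    (fun i s _ h => by
      simp only [hX0 s i h]
      linarith [hD0 i.succ (X s)])
  have hall : ∀ c, D c (X s) = D 0 (X s) := by
    intro c
    refine Fin.cases rfl (fun i => ?_) c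
    exact sub_eq_zero.1 (hs i)
  refine ⟨X s, D 0 (X s), fun H hH => ?_, fun c => ?_⟩
  · rw [← hall (color ⟨H, hH⟩)]
    exact hDle ⟨H, hH⟩ _
  · obtain ⟨H, hH, he⟩ := Finset.exists_mem_eq_inf' (hne c) fun H => |f H.1 (X s) - b H.1|
    exact ⟨H, (Finset.mem_filter.1 hH).2, he.symm.trans (hall c)⟩

/-! ### Perturbing the endpoints. -/

theorem mainTheorem6 {d : ℕ} (L : Finset (AffineSubspace ℝ (EuclideanSpace ℝ (Fin d))))
    (hyperplanes : ∀ H ∈ L, IsHyperplane H)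
    (simple : IsSimpleArrangement L)
    (color : {H // H ∈ L} → Fin (d + 1))
    (all_colors : Function.Surjective color) :
    ∃ x y : EuclideanSpace ℝ (Fin d),
      x ≠ y ∧
      (∀ H ∈ L, x ∉ H ∧ y ∉ H) ∧
      ∀ c : Fin (d + 1), ∃! H : {H // H ∈ L},
        color H = c ∧ (segment ℝ x y ∩ (H.1 : Set (EuclideanSpace ℝ (Fin d)))).Nonempty := by
  classical
  obtain ⟨u, hu⟩ := exists_notMem_direction L hyperplanes
  have hfun : ∀ H, ∃ (f : EuclideanSpace ℝ (Fin d) →ₗ[ℝ] ℝ) (b : ℝ),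
      H ∈ L → f u = 1 ∧ ∀ x, x ∈ H ↔ f x = b := by
    intro H
    by_cases hH : H ∈ L
    · obtain ⟨f, b, h⟩ := (hyperplanes H hH).exists_functional (hu H hH)
      exact ⟨f, b, fun _ => h⟩
    · exact ⟨0, 0, fun h => absurd h hH⟩
  choose f b hfb using hfun
  have hf : ∀ H ∈ L, ∀ x, x ∈ H ↔ f H x = b H := fun H hH => (hfb H hH).2
  obtain ⟨p, r, hr, hK⟩ := simple.exists_equidistant f b hf color all_colors
  choose K hKc hKr using hK
  have hr0 : 0 < r := by
    refine lt_of_le_of_ne (hKr 0 ▸ abs_nonneg _) fun h0 => ?_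
    have hinj : Function.Injective fun c => (K c).1 := fun c c' h => by
      rw [← hKc c, ← hKc c', Subtype.ext h]
    have hbot := simple.2 (Finset.univ.image fun c => (K c).1) (by
      intro H hH
      obtain ⟨c, -, rfl⟩ := Finset.mem_image.1 hH
      exact (K c).2) (by
      rw [Finset.card_image_of_injective _ hinj, Finset.card_univ, Fintype.card_fin]
      exact Nat.lt_succ_self d)
    refine AffineSubspace.notMem_bot ℝ _ p (hbot ▸ (AffineSubspace.mem_finset_inf _ p).2 ?_)
    intro H hH
    obtain ⟨c, -, rfl⟩ := Finset.mem_image.1 hH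
    have := hKr c
    rw [← h0, abs_eq_zero, sub_eq_zero] at this
    exact (hf _ (K c).2 p).2 this
  -- A hyperplane through an endpoint is crossed if that endpoint moves outward and avoided if it
  -- moves inward. The chosen `K c` are crossed, all others avoided.
  obtain ⟨w, hw⟩ := simple.exists_apply_eq f b hf (p - r • u)
    fun H => if ∃ c, (K c).1 = H then -1 else 1
  obtain ⟨w', hw'⟩ := simple.exists_apply_eq f b hf (p + r • u)
    fun H => if ∃ c, (K c).1 = H then 1 else -1
  have hpos : ∀ a : ℝ, ∀ᶠ δ in nhdsWithin (0 : ℝ) (Set.Ioi 0), 0 < 2 * r + δ * a := by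
    intro a
    have hc : Continuous fun δ : ℝ => 2 * r + δ * a := by fun_prop
    refine nhdsWithin_le_nhds (hc.continuousAt.eventually (lt_mem_nhds ?_))
    simpa using hr0
  have key : ∀ H ∈ L, ∀ᶠ δ in nhdsWithin (0 : ℝ) (Set.Ioi 0),
      ((∃ c, (K c).1 = H) → (f H (p - r • u + δ • w) - b H) * (f H (p + r • u + δ • w') - b H) < 0) ∧
      ((¬ ∃ c, (K c).1 = H) →
        0 < (f H (p - r • u + δ • w) - b H) * (f H (p + r • u + δ • w') - b H)) := by
    intro H hH
    simp only [map_add, map_sub, map_smul, smul_eq_mul, (hfb H hH).1, mul_one]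
    -- Either `H` passes through one endpoint, the other staying about `2 * r` away, or both
    -- endpoints are strictly on one side and remain so for small `δ`.
    rcases (hr H hH).eq_or_lt with he | hlt
    · rcases (abs_eq hr0.le).1 he.symm with h | h
      · have hfw := hw H hH ((hf H hH _).2 (by
          rw [map_sub, map_smul, (hfb H hH).1, smul_eq_mul]
          linarith))
        filter_upwards [hpos (f H w'), self_mem_nhdsWithin] with δ h1 h2
        have e : (f H p - r + δ * f H w - b H) * (f H p + r + δ * f H w' - b H) =
            δ * (2 * r + δ * f H w') * f H w := by
          rw [sub_eq_iff_eq_add.1 h]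
          ring
        have hp : 0 < δ * (2 * r + δ * f H w') := mul_pos h2 h1
        rw [e]
        refine ⟨fun hc => ?_, fun hc => ?_⟩
        · rw [hfw, if_pos hc]
          linarith
        · rw [hfw, if_neg hc]
          linarith
      · have hfw := hw' H hH ((hf H hH _).2 (by
          rw [map_add, map_smul, (hfb H hH).1, smul_eq_mul]
          linarith))
        filter_upwards [hpos (-f H w), self_mem_nhdsWithin] with δ h1 h2
        have e : (f H p - r + δ * f H w - b H) * (f H p + r + δ * f H w' - b H) =
            -(δ * (2 * r + δ * -f H w) * f H w') := by
          rw [sub_eq_iff_eq_add.1 h]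
          ring
        have hp : 0 < δ * (2 * r + δ * -f H w) := mul_pos h2 h1
        rw [e]
        refine ⟨fun hc => ?_, fun hc => ?_⟩
        · rw [hfw, if_pos hc]
          linarith
        · rw [hfw, if_neg hc]
          linarith
    · have hc : Continuous fun δ : ℝ =>
          (f H p - r + δ * f H w - b H) * (f H p + r + δ * f H w' - b H) := by fun_prop
      have h0 : 0 < (f H p - r + 0 * f H w - b H) * (f H p + r + 0 * f H w' - b H) := by
        have := (sq_lt_sq₀ hr0.le (abs_nonneg _)).2 hlt
        rw [sq_abs] at this
        linarith
      filter_upwards [nhdsWithin_le_nhds (hc.continuousAt.eventually (lt_mem_nhds h0))] with δ hδ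
      refine ⟨?_, fun _ => hδ⟩
      rintro ⟨c, rfl⟩
      exact absurd (hKr c) hlt.ne'
  obtain ⟨δ, hδ⟩ := ((Filter.eventually_all_finset L).2 key).exists
  set x := p - r • u + δ • w
  set y := p + r • u + δ • w'
  have hne0 : ∀ H ∈ L, (f H x - b H) * (f H y - b H) ≠ 0 := by
    intro H hH
    by_cases hc : ∃ c, (K c).1 = H
    · exact ((hδ H hH).1 hc).ne
    · exact ((hδ H hH).2 hc).ne'
  refine ⟨x, y, ?_, fun H hH => ⟨fun h => ?_, fun h => ?_⟩, fun c => ⟨K c, ⟨hKc c, ?_⟩, ?_⟩⟩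
  · intro hxy
    have := (hδ _ (K 0).2).1 ⟨0, rfl⟩
    rw [hxy] at this
    exact absurd this (mul_self_nonneg _).not_gt
  · exact hne0 H hH (by rw [(hf H hH x).1 h, sub_self, zero_mul])
  · exact hne0 H hH (by rw [(hf H hH y).1 h, sub_self, mul_zero])
  · rcases mul_neg_iff.1 ((hδ _ (K c).2).1 ⟨c, rfl⟩) with ⟨h1, h2⟩ | ⟨h1, h2⟩
    · obtain ⟨z, hz, he⟩ := segment_inter_level_set (f (K c).1) (b (K c).1) y x
        (by linarith) (by linarith)
      exact ⟨z, segment_symm ℝ y x ▸ hz, (hf _ (K c).2 z).2 he⟩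
    · obtain ⟨z, hz, he⟩ := segment_inter_level_set (f (K c).1) (b (K c).1) x y
        (by linarith) (by linarith)
      exact ⟨z, hz, (hf _ (K c).2 z).2 he⟩
  · rintro H ⟨hHc, z, hz, hzH⟩
    by_cases h : ∃ c', (K c').1 = H.1
    · obtain ⟨c', hc'⟩ := h
      have hKH : K c' = H := Subtype.ext hc'
      rw [← hKH, ← hHc, ← hKH, hKc]
    · exact absurd ((hf _ H.2 z).1 hzH)
        (mul_pos_of_mem_segment _ _ x y ((hδ _ H.2).2 h) z hz)
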